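/- All functions and distributions are complex valued and live on $\mathbb{R}$. For $p\in[1,\infty]$ let $\mathcal{D}_{L^p}$ be the space of $\varphi\in C^\infty(\mathbb{R})$ with $\varphi^{(j)}\in L^p$ for all $j\ge 0$, topologized by the norms $|\varphi|_{k,p}=\sum_{j\le k}\|\varphi^{(j)}\|_{L^p}$, $k\ge 0$. Let $\mathcal{D}'_{L^\infty}$ be the topological dual of $\mathcal{D}_{L^1}$ with the strong dual topology, and for $T\in\mathcal{D}'_{L^\infty}$, $\varphi\in\mathcal{D}_{L^1}$, $h\in\mathbb{R}$ put $\langle\tau_hT,\varphi\rangle=\langle T,\varphi(\cdot+h)\rangle$, $\langle T',\varphi\rangle=-\langle T,\varphi'\rangle$ and $(T*\varphi)(x)=\langle T,\varphi(x-\cdot)\rangle$. The space $\mathcal{B}'_{ap}$ of almost periodic distributions consists of those $T\in\mathcal{D}'_{L^\infty}$ for which $\{\tau_hT:h\in\mathbb{R}\}$ is relatively compact in $\mathcal{D}'_{L^\infty}$. Let $\mathcal{C}_{ap}$ be the set of (Bochner) almost periodic functions, i.e. continuous $f$ such that every sequence of translates of $f$ has a subsequence converging uniformly on $\mathbb{R}$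 in the space of bounded continuous functions, and let $\mathcal{B}_{ap}=\{\varphi\in\mathcal{D}_{L^\infty}:\varphi^{(j)}\in\mathcal{C}_{ap}\ \forall j\ge 0\}$. With $I=\,]0,1]$, let $\mathcal{M}_{ap}$ be the algebra of families $(u_\varepsilon)_\varepsilon\in(\mathcal{B}_{ap})^I$ such that for every $k\ge 0$ there is $m\ge 0$ with $|u_\varepsilon|_{k,\infty}=O(\varepsilon^{-m})$ as $\varepsilon\to 0$, let $\mathcal{N}_{ap}$ be its ideal of families such that $|u_\varepsilon|_{k,\infty}=O(\varepsilon^{m})$ as $\varepsilon\to 0$ for all $k,m\ge 0$, and let $\mathcal{G}_{ap}=\mathcal{M}_{ap}/\mathcal{N}_{ap}$, with the derivative $[(u_\varepsilon)_\varepsilon]'=[(u_\varepsilon')_\varepsilon]$. **Proposition.** Let $\rho$ be a Schwartz function on $\mathbb{R}$ with $\int\rho(x)\,dx=1$ and $\int x^k\rho(x)\,dx=0$ for all $k\ge 1$, and put $\rho_\varepsilon(x)=\varepsilon^{-1}\rho(x/\varepsilon)$. Then $(u*\rho_\varepsilon)_{\varepsilon\in I}\in\mathcal{M}_{ap}$ for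 every $u\in\mathcal{B}'_{ap}$, and the map $$i_{ap}:\mathcal{B}'_{ap}\to\mathcal{G}_{ap},\qquad u\mapsto (u*\rho_\varepsilon)_\varepsilon+\mathcal{N}_{ap},$$ is linear, injective, and commutes with derivatives: $i_{ap}(u^{(j)})=(i_{ap}(u))^{(j)}$ for all $u\in\mathcal{B}'_{ap}$ and $j\ge 0$. -/

import Mathlib

open Filter Topology MeasureTheory
open scoped ENNReal ContDiff SchwartzMap BoundedContinuousFunction

noncomputable section

namespace APGen

/-! ### The spaces `D_{L^p}` -/

/-- The smooth functions `φ : ℝ → ℂ` all of whose derivatives lie in `L^p`. -/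
def dlpSubmodule (p : ℝ≥0∞) : Submodule ℂ (ℝ → ℂ) where
  carrier := {φ | ContDiff ℝ ∞ φ ∧ ∀ j : ℕ, MemLp (iteratedDeriv j φ) p volume}
  zero_mem' := by
    refine ⟨contDiff_const, fun j => ?_⟩
    have : iteratedDeriv j (0 : ℝ → ℂ) = 0 := by
      funext x; exact iteratedDeriv_const_zero
    rw [this]
    exact MemLp.zero
  add_mem' := by
    rintro f g ⟨hf, hf'⟩ ⟨hg, hg'⟩
    refine ⟨hf.add hg, fun j => ?_⟩
    have : iteratedDeriv j (f + g) = iteratedDeriv j f + iteratedDeriv j g := by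
      funext x
      exact iteratedDeriv_add (hf.of_le (by exact_mod_cast le_top)).contDiffAt
        (hg.of_le (by exact_mod_cast le_top)).contDiffAt
    rw [this]
    exact (hf' j).add (hg' j)
  smul_mem' := by
    rintro c f ⟨hf, hf'⟩
    refine ⟨hf.const_smul c, fun j => ?_⟩
    have : iteratedDeriv j (c • f) = c • iteratedDeriv j f := by
      funext x
      exact iteratedDeriv_const_smul_field c f
    rw [this]
    exact (hf' j).const_smul c

theorem dlp_iteratedDeriv_add {p : ℝ≥0∞} {f g : ℝ → ℂ} (hf : f ∈ dlpSubmodule p)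
    (hg : g ∈ dlpSubmodule p) (j : ℕ) :
    iteratedDeriv j (f + g) = iteratedDeriv j f + iteratedDeriv j g := by
  funext x
  exact iteratedDeriv_add (hf.1.of_le (by exact_mod_cast le_top)).contDiffAt
    (hg.1.of_le (by exact_mod_cast le_top)).contDiffAt

theorem iteratedDeriv_smul_fun (c : ℂ) (f : ℝ → ℂ) (j : ℕ) :
    iteratedDeriv j (c • f) = c • iteratedDeriv j f := by
  funext x
  exact iteratedDeriv_const_smul_field c f

theorem dlp_deriv_mem {p : ℝ≥0∞} {f : ℝ → ℂ} (hf : f ∈ dlpSubmodule p) :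
    deriv f ∈ dlpSubmodule p := by
  refine ⟨(contDiff_infty_iff_deriv.1 hf.1).2, fun j => ?_⟩
  rw [← iteratedDeriv_succ']
  exact hf.2 (j + 1)

/-- The norm `|φ|_{k,p} = ∑_{j ≤ k} ‖φ^{(j)}‖_{L^p}`. -/
def dlpNorm (p : ℝ≥0∞) (k : ℕ) (φ : ℝ → ℂ) : ℝ :=
  ∑ j ∈ Finset.range (k + 1), (eLpNorm (iteratedDeriv j φ) p volume).toReal

theorem dlpNorm_nonneg (p : ℝ≥0∞) (k : ℕ) (φ : ℝ → ℂ) : 0 ≤ dlpNorm p k φ :=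
  Finset.sum_nonneg fun _ _ => ENNReal.toReal_nonneg

theorem dlpNorm_smul (p : ℝ≥0∞) (k : ℕ) (c : ℂ) (f : ℝ → ℂ) :
    dlpNorm p k (c • f) = ‖c‖ * dlpNorm p k f := by
  unfold dlpNorm
  rw [Finset.mul_sum]
  refine Finset.sum_congr rfl fun j _ => ?_
  rw [iteratedDeriv_smul_fun, eLpNorm_const_smul, ENNReal.toReal_mul, toReal_enorm]

theorem dlpNorm_add_le {p : ℝ≥0∞} (hp : 1 ≤ p) (k : ℕ) {f g : ℝ → ℂ}
    (hf : f ∈ dlpSubmodule p) (hg : g ∈ dlpSubmodule p) :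
    dlpNorm p k (f + g) ≤ dlpNorm p k f + dlpNorm p k g := by
  unfold dlpNorm
  rw [← Finset.sum_add_distrib]
  refine Finset.sum_le_sum fun j _ => ?_
  rw [dlp_iteratedDeriv_add hf hg,
    ← ENNReal.toReal_add (hf.2 j).eLpNorm_ne_top (hg.2 j).eLpNorm_ne_top]
  exact ENNReal.toReal_mono
    (ENNReal.add_ne_top.2 ⟨(hf.2 j).eLpNorm_ne_top, (hg.2 j).eLpNorm_ne_top⟩)
    (eLpNorm_add_le (hf.2 j).1 (hg.2 j).1 hp)

theorem dlpNorm_deriv_le (p : ℝ≥0∞) (k : ℕ) (f : ℝ → ℂ) :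
    dlpNorm p k (deriv f) ≤ dlpNorm p (k + 1) f := by
  unfold dlpNorm
  rw [Finset.sum_range_succ' _ (k + 1)]
  simp only [iteratedDeriv_succ']
  exact le_add_of_nonneg_right ENNReal.toReal_nonneg

/-- The space `D_{L^p}`. It is a type of its own, so that it carries only the topology given by
the norms `|·|_{k,p}` and not the topology of pointwise convergence. -/
def DLp (p : ℝ≥0∞) : Type := ↥(dlpSubmodule p)

instance (p : ℝ≥0∞) : AddCommGroup (DLp p) := inferInstanceAs (AddCommGroup ↥(dlpSubmodule p))

instance (p : ℝ≥0∞) : Module ℂ (DLp p) := inferInstanceAs (Module ℂ ↥(dlpSubmodule p))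

/-- The underlying function of an element of `D_{L^p}`. -/
def DLp.toFun {p : ℝ≥0∞} (φ : DLp p) : ℝ → ℂ := φ.1

instance (p : ℝ≥0∞) : CoeFun (DLp p) (fun _ => ℝ → ℂ) := ⟨DLp.toFun⟩

/-- The family of norms `|·|_{k,p}`, `k = 0, 1, 2, …`, on `D_{L^p}`. -/
def dlpSeminorms (p : ℝ≥0∞) [hp : Fact (1 ≤ p)] : SeminormFamily ℂ (DLp p) ℕ := fun k =>
  Seminorm.of (fun φ => dlpNorm p k φ)
    (fun φ ψ => dlpNorm_add_le hp.out k φ.2 ψ.2) (fun c φ => dlpNorm_smul p k c φ.1)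

instance (p : ℝ≥0∞) [Fact (1 ≤ p)] : TopologicalSpace (DLp p) :=
  (dlpSeminorms p).moduleFilterBasis.topology

theorem dlp_withSeminorms (p : ℝ≥0∞) [Fact (1 ≤ p)] : WithSeminorms (dlpSeminorms p) := ⟨rfl⟩

instance (p : ℝ≥0∞) [Fact (1 ≤ p)] : IsTopologicalAddGroup (DLp p) :=
  (dlp_withSeminorms p).topologicalAddGroup

instance (p : ℝ≥0∞) [Fact (1 ≤ p)] : ContinuousSMul ℂ (DLp p) :=
  (dlp_withSeminorms p).continuousSMul

theorem dlp_continuous_of_le {p : ℝ≥0∞} [Fact (1 ≤ p)] (A : DLp p →ₗ[ℂ] DLp p) (s : ℕ)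
    (hA : ∀ k φ, dlpNorm p k (A φ) ≤ dlpNorm p (k + s) φ) : Continuous A := by
  refine WithSeminorms.continuous_of_isBounded (dlp_withSeminorms p) (dlp_withSeminorms p) A ?_
  intro k
  refine ⟨{k + s}, 1, ?_⟩
  intro φ
  simp only [Seminorm.comp_apply, Finset.sup_singleton, one_smul]
  exact hA k φ

/-- Differentiation on `D_{L^p}`. -/
def DLp.derivLM (p : ℝ≥0∞) : DLp p →ₗ[ℂ] DLp p where
  toFun φ := ⟨deriv φ, dlp_deriv_mem φ.2⟩
  map_add' φ ψ := by
    refine Subtype.ext (funext fun x => ?_)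
    exact deriv_add (φ.2.1.differentiable (by simp) x) (ψ.2.1.differentiable (by simp) x)
  map_smul' c φ := by
    refine Subtype.ext (funext fun x => ?_)
    exact deriv_const_smul c (φ.2.1.differentiable (by simp) x)

/-- Differentiation on `D_{L^p}` as a continuous linear map. -/
def DLp.derivCLM (p : ℝ≥0∞) [Fact (1 ≤ p)] : DLp p →L[ℂ] DLp p where
  toLinearMap := DLp.derivLM p
  cont := dlp_continuous_of_le (DLp.derivLM p) 1 (fun k φ => dlpNorm_deriv_le p k φ)

theorem iteratedDeriv_translate (f : ℝ → ℂ) (h : ℝ) (j : ℕ) :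
    iteratedDeriv j (fun x => f (x + h)) = fun x => iteratedDeriv j f (x + h) :=
  iteratedDeriv_comp_add_const j f h

theorem dlp_translate_mem {p : ℝ≥0∞} {f : ℝ → ℂ} (hf : f ∈ dlpSubmodule p) (h : ℝ) :
    (fun x => f (x + h)) ∈ dlpSubmodule p := by
  refine ⟨hf.1.comp (contDiff_id.add contDiff_const), fun j => ?_⟩
  rw [iteratedDeriv_translate]
  exact (hf.2 j).comp_measurePreserving (measurePreserving_add_right volume h)

theorem dlpNorm_translate {p : ℝ≥0∞} {f : ℝ → ℂ} (hf : f ∈ dlpSubmodule p) (h : ℝ) (k : ℕ) :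
    dlpNorm p k (fun x => f (x + h)) = dlpNorm p k f := by
  unfold dlpNorm
  refine Finset.sum_congr rfl fun j _ => ?_
  rw [iteratedDeriv_translate]
  have e : eLpNorm (iteratedDeriv j f ∘ fun x => x + h) p volume
      = eLpNorm (iteratedDeriv j f) p volume :=
    eLpNorm_comp_measurePreserving (hf.2 j).1 (measurePreserving_add_right volume h)
  rw [← e]
  rfl

/-- The translation `φ ↦ φ(· + h)` on `D_{L^p}`. -/
def DLp.shiftLM (p : ℝ≥0∞) (h : ℝ) : DLp p →ₗ[ℂ] DLp p where
  toFun φ := ⟨fun x => φ (x + h), dlp_translate_mem φ.2 h⟩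
  map_add' _ _ := rfl
  map_smul' _ _ := rfl

/-- The translation `φ ↦ φ(· + h)` on `D_{L^p}` as a continuous linear map. -/
def DLp.shiftCLM (p : ℝ≥0∞) [Fact (1 ≤ p)] (h : ℝ) : DLp p →L[ℂ] DLp p where
  toLinearMap := DLp.shiftLM p h
  cont := dlp_continuous_of_le (DLp.shiftLM p h) 0 (fun k φ => (dlpNorm_translate φ.2 h k).le)

theorem dl1_affine_mem {f : ℝ → ℂ} (hf : f ∈ dlpSubmodule 1) {a : ℝ} (ha : a ≠ 0) (b : ℝ) :
    (fun x => f (a * x + b)) ∈ dlpSubmodule 1 := by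
  have hg := dlp_translate_mem hf b
  refine ⟨hg.1.comp (contDiff_const.mul contDiff_id), fun j => ?_⟩
  have h1 := iteratedDeriv_comp_const_smul (n := j) (f := fun x => f (x + b))
    (hg.1.of_le (by exact_mod_cast le_top)) a
  rw [h1, memLp_one_iff_integrable]
  exact ((memLp_one_iff_integrable.1 (hg.2 j)).comp_mul_left' ha).smul (a ^ j)

/-- For `φ ∈ D_{L^1}` and `x ∈ ℝ`, the function `y ↦ φ(x - y)` as an element of `D_{L^1}`. -/
def DLp.reflectAt (φ : DLp 1) (x : ℝ) : DLp 1 :=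
  ⟨fun y => φ (x - y), by
    have h := dl1_affine_mem φ.2 (a := -1) (by norm_num) x
    have e : (fun y => φ (x - y)) = fun y => φ.1 (-1 * y + x) := by
      funext y
      have h1 : x - y = -1 * y + x := by ring
      rw [h1]
      rfl
    rw [e]
    exact h⟩

/-! ### Bounded distributions -/

/-- The space `D'_{L^∞}` of bounded distributions: the topological dual of `D_{L^1}`. As a space of
continuous linear maps it carries the strong dual topology, that is, uniform convergence on the
bounded subsets of `D_{L^1}`. -/
abbrev BoundedDistribution : Type := DLp 1 →L[ℂ] ℂ

/-- The translate `τ_h T`, given by `⟨τ_h T, φ⟩ = ⟨T, φ(· + h)⟩`. -/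
def translateDistr (h : ℝ) : BoundedDistribution →L[ℂ] BoundedDistribution :=
  ContinuousLinearMap.precomp ℂ (DLp.shiftCLM 1 h)

/-- The distributional derivative `T'`, given by `⟨T', φ⟩ = -⟨T, φ'⟩`. -/
def derivDistr : BoundedDistribution →L[ℂ] BoundedDistribution :=
  -ContinuousLinearMap.precomp ℂ (DLp.derivCLM 1)

/-- The convolution `T * φ`, given by `(T * φ)(x) = ⟨T, φ(x - ·)⟩`. -/
def convDistr (T : BoundedDistribution) (φ : DLp 1) : ℝ → ℂ :=
  fun x => T (φ.reflectAt x)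

theorem derivDistr_translate (h : ℝ) (T : BoundedDistribution) :
    translateDistr h (derivDistr T) = derivDistr (translateDistr h T) := by
  refine ContinuousLinearMap.ext fun φ => ?_
  show -T (DLp.derivCLM 1 (DLp.shiftCLM 1 h φ)) = -T (DLp.shiftCLM 1 h (DLp.derivCLM 1 φ))
  congr 2
  refine Subtype.ext (funext fun x => ?_)
  exact deriv_comp_add_const _ h x

/-- The space `B'_ap` of almost periodic distributions: the bounded distributions `T` whose set of
translates `{τ_h T : h ∈ ℝ}` is relatively compact in `D'_{L^∞}`. -/
def apDistributions : Submodule ℂ BoundedDistribution where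
  carrier := {T | IsCompact (closure (Set.range fun h : ℝ => translateDistr h T))}
  zero_mem' := by
    have : (Set.range fun h : ℝ => translateDistr h 0) = {0} := by simp
    show IsCompact _
    rw [this]
    exact isCompact_singleton.closure
  add_mem' := by
    intro S T hS hT
    refine (hS.add hT).closure_of_subset ?_
    rintro _ ⟨h, rfl⟩
    exact ⟨_, subset_closure ⟨h, rfl⟩, _, subset_closure ⟨h, rfl⟩,
      ((translateDistr h).map_add S T).symm⟩
  smul_mem' := by
    intro c T hT
    refine (hT.image (continuous_const_smul c)).closure_of_subset ?_
    rintro _ ⟨h, rfl⟩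
    exact ⟨_, subset_closure ⟨h, rfl⟩, ((translateDistr h).map_smul c T).symm⟩

/-- Differentiation on `B'_ap`. -/
def derivAp : apDistributions →ₗ[ℂ] apDistributions :=
  derivDistr.toLinearMap.restrict (by
    intro T hT
    refine (IsCompact.image (hT : IsCompact _) derivDistr.continuous).closure_of_subset ?_
    rintro _ ⟨h, rfl⟩
    exact ⟨_, subset_closure ⟨h, rfl⟩, (derivDistr_translate h T).symm⟩)

/-! ### Almost periodic functions -/

/-- The translate `f(· + h)` of a bounded continuous function. -/
def translateBCF (F : ℝ →ᵇ ℂ) (h : ℝ) : ℝ →ᵇ ℂ :=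
  F.compContinuous ⟨fun x => x + h, by fun_prop⟩

/-- Bochner's definition of an almost periodic function: every sequence of translates of `f` has a
subsequence that converges in the Banach space `C_b` of bounded continuous functions. -/
def IsAlmostPeriodicFun (f : ℝ → ℂ) : Prop :=
  ∃ F : ℝ →ᵇ ℂ, ⇑F = f ∧ ∀ h : ℕ → ℝ, ∃ s : ℕ → ℕ, StrictMono s ∧
    ∃ G : ℝ →ᵇ ℂ, Tendsto (fun k => translateBCF F (h (s k))) atTop (𝓝 G)

theorem IsAlmostPeriodicFun.const (c : ℂ) : IsAlmostPeriodicFun (fun _ => c) :=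
  ⟨BoundedContinuousFunction.const ℝ c, rfl, fun _ => ⟨id, strictMono_id,
    BoundedContinuousFunction.const ℝ c, tendsto_const_nhds⟩⟩

theorem IsAlmostPeriodicFun.add {f g : ℝ → ℂ} (hf : IsAlmostPeriodicFun f)
    (hg : IsAlmostPeriodicFun g) : IsAlmostPeriodicFun (f + g) := by
  obtain ⟨F, rfl, hF⟩ := hf
  obtain ⟨G, rfl, hG⟩ := hg
  refine ⟨F + G, rfl, fun h => ?_⟩
  obtain ⟨s, hs, A, hA⟩ := hF h
  obtain ⟨t, ht, B, hB⟩ := hG (h ∘ s)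
  exact ⟨s ∘ t, hs.comp ht, A + B, (hA.comp ht.tendsto_atTop).add hB⟩

theorem IsAlmostPeriodicFun.mul {f g : ℝ → ℂ} (hf : IsAlmostPeriodicFun f)
    (hg : IsAlmostPeriodicFun g) : IsAlmostPeriodicFun (f * g) := by
  obtain ⟨F, rfl, hF⟩ := hf
  obtain ⟨G, rfl, hG⟩ := hg
  refine ⟨F * G, rfl, fun h => ?_⟩
  obtain ⟨s, hs, A, hA⟩ := hF h
  obtain ⟨t, ht, B, hB⟩ := hG (h ∘ s)
  exact ⟨s ∘ t, hs.comp ht, A * B, (hA.comp ht.tendsto_atTop).mul hB⟩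

theorem IsAlmostPeriodicFun.sum {ι : Type*} (s : Finset ι) {f : ι → ℝ → ℂ}
    (hf : ∀ i ∈ s, IsAlmostPeriodicFun (f i)) : IsAlmostPeriodicFun (∑ i ∈ s, f i) := by
  classical
  induction s using Finset.induction_on with
  | empty => exact IsAlmostPeriodicFun.const 0
  | insert a s ha ih =>
    rw [Finset.sum_insert ha]
    exact (hf a (Finset.mem_insert_self a s)).add
      (ih fun i hi => hf i (Finset.mem_insert_of_mem hi))

theorem iteratedDeriv_mul_fun {f g : ℝ → ℂ} (hf : ContDiff ℝ ∞ f) (hg : ContDiff ℝ ∞ g) (j : ℕ) :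
    iteratedDeriv j (f * g) = ∑ i ∈ Finset.range (j + 1),
      (fun _ => (j.choose i : ℂ)) * iteratedDeriv i f * iteratedDeriv (j - i) g := by
  funext x
  rw [iteratedDeriv_mul (hf.of_le (by exact_mod_cast le_top)).contDiffAt
    (hg.of_le (by exact_mod_cast le_top)).contDiffAt]
  simp

theorem eLpNorm_top_mul_le (f g : ℝ → ℂ) :
    eLpNorm (f * g) ∞ volume ≤ eLpNorm f ∞ volume * eLpNorm g ∞ volume := by
  simp only [eLpNorm_exponent_top, eLpNormEssSup_eq_essSup_enorm, Pi.mul_apply, enorm_mul]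
  exact ENNReal.essSup_mul_le _ _

theorem memLp_top_choose_mul {f g : ℝ → ℂ} (hf : MemLp f ∞ volume) (hg : MemLp g ∞ volume)
    (c : ℂ) : MemLp ((fun _ => c) * f * g) ∞ volume := by
  have h1 : MemLp ((fun _ => c) * f) ∞ volume := hf.mul (p := ∞) (memLp_top_const c)
  exact hg.mul (p := ∞) h1

theorem dlInf_mul_mem {f g : ℝ → ℂ} (hf : f ∈ dlpSubmodule ∞) (hg : g ∈ dlpSubmodule ∞) :
    f * g ∈ dlpSubmodule ∞ := by
  refine ⟨hf.1.mul hg.1, fun j => ?_⟩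
  rw [iteratedDeriv_mul_fun hf.1 hg.1]
  exact memLp_finsetSum' _ fun i _ => memLp_top_choose_mul (hf.2 i) (hg.2 (j - i)) _

theorem iteratedDeriv_const_fun (c : ℂ) (j : ℕ) :
    iteratedDeriv j (fun _ : ℝ => c) = fun _ => if j = 0 then c else 0 := by
  funext x
  exact iteratedDeriv_const

/-- The algebra `B_ap` of the functions in `D_{L^∞}` all of whose derivatives are almost
periodic. -/
def Bap : Subalgebra ℂ (ℝ → ℂ) where
  carrier := {φ | φ ∈ dlpSubmodule ∞ ∧ ∀ j : ℕ, IsAlmostPeriodicFun (iteratedDeriv j φ)}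
  mul_mem' := by
    rintro f g ⟨hf, hf'⟩ ⟨hg, hg'⟩
    refine ⟨dlInf_mul_mem hf hg, fun j => ?_⟩
    rw [iteratedDeriv_mul_fun hf.1 hg.1]
    exact IsAlmostPeriodicFun.sum _ fun i _ =>
      ((IsAlmostPeriodicFun.const _).mul (hf' i)).mul (hg' _)
  add_mem' := by
    rintro f g ⟨hf, hf'⟩ ⟨hg, hg'⟩
    refine ⟨add_mem hf hg, fun j => ?_⟩
    rw [dlp_iteratedDeriv_add hf hg]
    exact (hf' j).add (hg' j)
  algebraMap_mem' := by
    intro c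
    refine ⟨⟨contDiff_const, fun j => ?_⟩, fun j => ?_⟩
    · show MemLp (iteratedDeriv j (fun _ : ℝ => c)) ∞ volume
      rw [iteratedDeriv_const_fun]
      exact memLp_top_const _
    · show IsAlmostPeriodicFun (iteratedDeriv j (fun _ : ℝ => c))
      rw [iteratedDeriv_const_fun]
      exact IsAlmostPeriodicFun.const _

instance : CommRing Bap := Bap.toCommRing

/-- Differentiation on `B_ap`. -/
def Bap.deriv : Bap →ₗ[ℂ] Bap where
  toFun φ := ⟨_root_.deriv φ, dlp_deriv_mem φ.2.1, fun j => by
    rw [← iteratedDeriv_succ']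
    exact φ.2.2 (j + 1)⟩
  map_add' φ ψ := by
    refine Subtype.ext (funext fun x => ?_)
    exact deriv_add (φ.2.1.1.differentiable (by simp) x) (ψ.2.1.1.differentiable (by simp) x)
  map_smul' c φ := by
    refine Subtype.ext (funext fun x => ?_)
    exact deriv_const_smul c (φ.2.1.1.differentiable (by simp) x)

theorem dlpNorm_mul_le {f g : ℝ → ℂ} (hf : f ∈ dlpSubmodule ∞) (hg : g ∈ dlpSubmodule ∞)
    (k : ℕ) :
    dlpNorm ∞ k (f * g) ≤ ((k + 1) * 2 ^ k : ℝ) * (dlpNorm ∞ k f * dlpNorm ∞ k g) := by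
  have key : ∀ {f : ℝ → ℂ} (i : ℕ), i ≤ k →
      (eLpNorm (iteratedDeriv i f) ∞ volume).toReal ≤ dlpNorm ∞ k f := fun {f} i hi =>
    Finset.single_le_sum (f := fun j => (eLpNorm (iteratedDeriv j f) ∞ volume).toReal)
      (fun _ _ => ENNReal.toReal_nonneg) (Finset.mem_range.2 (by omega))
  have hN : 0 ≤ dlpNorm ∞ k f * dlpNorm ∞ k g :=
    mul_nonneg (dlpNorm_nonneg _ _ _) (dlpNorm_nonneg _ _ _)
  have hj : ∀ j ∈ Finset.range (k + 1),
      (eLpNorm (iteratedDeriv j (f * g)) ∞ volume).toReal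
        ≤ 2 ^ k * (dlpNorm ∞ k f * dlpNorm ∞ k g) := by
    intro j hj
    have hjk : j ≤ k := by simpa [Nat.lt_succ_iff] using hj
    have hm : ∀ i, MemLp ((fun _ => (j.choose i : ℂ)) * iteratedDeriv i f *
        iteratedDeriv (j - i) g) ∞ volume :=
      fun i => memLp_top_choose_mul (hf.2 i) (hg.2 (j - i)) _
    rw [iteratedDeriv_mul_fun hf.1 hg.1]
    calc _ ≤ (∑ i ∈ Finset.range (j + 1), eLpNorm ((fun _ => (j.choose i : ℂ)) *
              iteratedDeriv i f * iteratedDeriv (j - i) g) ∞ volume).toReal := by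
            refine ENNReal.toReal_mono (ENNReal.sum_ne_top.2 fun i _ => (hm i).eLpNorm_ne_top) ?_
            exact eLpNorm_sum_le (fun i _ => (hm i).1) le_top
      _ = ∑ i ∈ Finset.range (j + 1), (eLpNorm ((fun _ => (j.choose i : ℂ)) *
              iteratedDeriv i f * iteratedDeriv (j - i) g) ∞ volume).toReal :=
            ENNReal.toReal_sum fun i _ => (hm i).eLpNorm_ne_top
      _ ≤ ∑ i ∈ Finset.range (j + 1), (j.choose i : ℝ) * (dlpNorm ∞ k f * dlpNorm ∞ k g) := by
            refine Finset.sum_le_sum fun i hi => ?_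
            have hij : i ≤ j := by simpa [Nat.lt_succ_iff] using hi
            have e : (fun _ => (j.choose i : ℂ)) * iteratedDeriv i f * iteratedDeriv (j - i) g
                = (j.choose i : ℂ) • (iteratedDeriv i f * iteratedDeriv (j - i) g) := by
              funext x
              simp [mul_assoc]
            rw [e, eLpNorm_const_smul, ENNReal.toReal_mul, toReal_enorm, Complex.norm_natCast]
            refine mul_le_mul_of_nonneg_left ?_ (Nat.cast_nonneg _)
            calc _ ≤ (eLpNorm (iteratedDeriv i f) ∞ volume *
                    eLpNorm (iteratedDeriv (j - i) g) ∞ volume).toReal :=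
                  ENNReal.toReal_mono (ENNReal.mul_ne_top (hf.2 i).eLpNorm_ne_top
                    (hg.2 (j - i)).eLpNorm_ne_top) (eLpNorm_top_mul_le _ _)
              _ ≤ _ := by
                  rw [ENNReal.toReal_mul]
                  exact mul_le_mul (key i (hij.trans hjk)) (key (j - i) (by omega))
                    ENNReal.toReal_nonneg (dlpNorm_nonneg _ _ _)
      _ = 2 ^ j * (dlpNorm ∞ k f * dlpNorm ∞ k g) := by
            rw [← Finset.sum_mul]
            congr 1
            exact_mod_cast Nat.sum_range_choose j
      _ ≤ 2 ^ k * (dlpNorm ∞ k f * dlpNorm ∞ k g) :=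
            mul_le_mul_of_nonneg_right (pow_le_pow_right₀ (by norm_num) hjk) hN
  calc dlpNorm ∞ k (f * g)
      ≤ ∑ j ∈ Finset.range (k + 1), 2 ^ k * (dlpNorm ∞ k f * dlpNorm ∞ k g) :=
        Finset.sum_le_sum hj
    _ = _ := by
        rw [Finset.sum_const, Finset.card_range, nsmul_eq_mul]
        push_cast
        ring

/-! ### The algebra of almost periodic generalized functions -/

/-- The parameter set `I = ]0, 1]`. -/
abbrev ParamI : Type := ↥(Set.Ioc (0 : ℝ) 1)

/-- The filter `ε → 0` on `I`. -/
def toZero : Filter ParamI := comap (fun ε : ParamI => (ε : ℝ)) (𝓝 0)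

theorem mul_norm_isBigO {u v : ParamI → Bap} {k : ℕ} {a b : ParamI → ℝ}
    (hu : (fun ε => dlpNorm ∞ k (u ε)) =O[toZero] a)
    (hv : (fun ε => dlpNorm ∞ k (v ε)) =O[toZero] b) :
    (fun ε => dlpNorm ∞ k ((u * v) ε : Bap)) =O[toZero] fun ε => a ε * b ε := by
  refine Asymptotics.IsBigO.trans ?_ (hu.mul hv)
  refine Asymptotics.IsBigO.of_bound ((k + 1) * 2 ^ k : ℝ) (Eventually.of_forall fun ε => ?_)
  rw [Real.norm_of_nonneg (dlpNorm_nonneg _ _ _), Real.norm_of_nonneg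
    (mul_nonneg (dlpNorm_nonneg _ _ _) (dlpNorm_nonneg _ _ _))]
  exact dlpNorm_mul_le (u ε).2.1 (v ε).2.1 k

theorem add_norm_isBigO {u v : ParamI → Bap} {k : ℕ} {a : ParamI → ℝ}
    (hu : (fun ε => dlpNorm ∞ k (u ε)) =O[toZero] a)
    (hv : (fun ε => dlpNorm ∞ k (v ε)) =O[toZero] a) :
    (fun ε => dlpNorm ∞ k ((u + v) ε : Bap)) =O[toZero] a := by
  refine Asymptotics.IsBigO.trans ?_ (hu.add hv)
  refine Asymptotics.IsBigO.of_bound 1 (Eventually.of_forall fun ε => ?_)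
  rw [Real.norm_of_nonneg (dlpNorm_nonneg _ _ _), Real.norm_of_nonneg
    (add_nonneg (dlpNorm_nonneg _ _ _) (dlpNorm_nonneg _ _ _)), one_mul]
  exact dlpNorm_add_le le_top k (u ε).2.1 (v ε).2.1

theorem zpow_neg_isBigO {m n : ℕ} (h : m ≤ n) :
    (fun ε : ParamI => (ε : ℝ) ^ (-(m : ℤ))) =O[toZero] fun ε => (ε : ℝ) ^ (-(n : ℤ)) := by
  refine Asymptotics.IsBigO.of_bound 1 (Eventually.of_forall fun ε => ?_)
  have h0 : (0 : ℝ) < ε := ε.2.1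
  rw [Real.norm_of_nonneg (zpow_nonneg h0.le _), Real.norm_of_nonneg (zpow_nonneg h0.le _), one_mul]
  exact zpow_le_zpow_right_of_le_one₀ h0 ε.2.2 (by omega)

/-- The algebra `M_ap` of moderate families in `B_ap`. -/
def ModerateAp : Subalgebra ℂ (ParamI → Bap) where
  carrier := {u | ∀ k : ℕ, ∃ m : ℕ,
    (fun ε => dlpNorm ∞ k (u ε)) =O[toZero] fun ε => (ε : ℝ) ^ (-(m : ℤ))}
  mul_mem' := by
    intro u v hu hv k
    obtain ⟨m, hm⟩ := hu k
    obtain ⟨n, hn⟩ := hv k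
    refine ⟨m + n, (mul_norm_isBigO hm hn).congr_right fun ε => ?_⟩
    rw [← zpow_add₀ ε.2.1.ne']
    congr 1
    push_cast
    ring
  add_mem' := by
    intro u v hu hv k
    obtain ⟨m, hm⟩ := hu k
    obtain ⟨n, hn⟩ := hv k
    exact ⟨max m n, add_norm_isBigO (hm.trans (zpow_neg_isBigO (le_max_left m n)))
      (hn.trans (zpow_neg_isBigO (le_max_right m n)))⟩
  algebraMap_mem' := by
    intro c k
    refine ⟨0, ?_⟩
    simp only [Nat.cast_zero, neg_zero, zpow_zero]
    exact Asymptotics.isBigO_const_const (dlpNorm ∞ k (fun _ : ℝ => c)) one_ne_zero _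

instance : CommRing ModerateAp := ModerateAp.toCommRing

/-- The ideal `N_ap` of negligible families in `M_ap`. -/
def NegligibleAp : Ideal ModerateAp where
  carrier := {u | ∀ k m : ℕ,
    (fun ε => dlpNorm ∞ k (u.1 ε)) =O[toZero] fun ε => (ε : ℝ) ^ m}
  add_mem' := by
    intro u v hu hv k m
    exact add_norm_isBigO (hu k m) (hv k m)
  zero_mem' := by
    intro k m
    have : ∀ ε, dlpNorm ∞ k ((0 : ModerateAp).1 ε) = 0 := fun ε => by
      have := dlpNorm_smul ∞ k 0 (0 : ℝ → ℂ)
      simpa using this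
    simp only [this]
    exact Asymptotics.isBigO_zero _ _
  smul_mem' := by
    intro v u hu k m
    obtain ⟨n, hn⟩ := v.2 k
    refine (mul_norm_isBigO hn (hu k (m + n))).congr_right fun ε => ?_
    have h0 : (ε : ℝ) ≠ 0 := ε.2.1.ne'
    rw [pow_add, zpow_neg, zpow_natCast]
    field_simp

/-- The algebra `G_ap = M_ap / N_ap` of almost periodic generalized functions. -/
abbrev Gap : Type := ModerateAp ⧸ NegligibleAp

/-- Componentwise differentiation `(u_ε)_ε ↦ (u_ε')_ε` on `M_ap`. -/
def ModerateAp.deriv : ModerateAp →ₗ[ℂ] ModerateAp where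
  toFun u := ⟨fun ε => Bap.deriv (u.1 ε), fun k => by
    obtain ⟨m, hm⟩ := u.2 (k + 1)
    refine ⟨m, Asymptotics.IsBigO.trans (Asymptotics.IsBigO.of_bound 1
      (Eventually.of_forall fun ε => ?_)) hm⟩
    rw [Real.norm_of_nonneg (dlpNorm_nonneg _ _ _), Real.norm_of_nonneg (dlpNorm_nonneg _ _ _),
      one_mul]
    exact dlpNorm_deriv_le _ _ _⟩
  map_add' u v := Subtype.ext (funext fun ε => Bap.deriv.map_add (u.1 ε) (v.1 ε))
  map_smul' c u := Subtype.ext (funext fun ε => Bap.deriv.map_smul c (u.1 ε))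

theorem ModerateAp.deriv_mem_Nap {u : ModerateAp} (hu : u ∈ NegligibleAp) : ModerateAp.deriv u ∈ NegligibleAp := by
  intro k m
  refine Asymptotics.IsBigO.trans (Asymptotics.IsBigO.of_bound 1
    (Eventually.of_forall fun ε => ?_)) (hu (k + 1) m)
  rw [Real.norm_of_nonneg (dlpNorm_nonneg _ _ _), Real.norm_of_nonneg (dlpNorm_nonneg _ _ _),
    one_mul]
  exact dlpNorm_deriv_le _ _ _

/-- Differentiation on `G_ap`: `[(u_ε)_ε]' = [(u_ε')_ε]`. -/
def Gap.deriv : Gap →ₗ[ℂ] Gap where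
  toFun := Quotient.map' ModerateAp.deriv (by
    intro u v h
    rw [Submodule.quotientRel_def] at h ⊢
    rw [← map_sub]
    exact ModerateAp.deriv_mem_Nap h)
  map_add' := by
    rintro ⟨u⟩ ⟨v⟩
    exact congrArg (Ideal.Quotient.mk NegligibleAp) (ModerateAp.deriv.map_add u v)
  map_smul' := by
    rintro c ⟨u⟩
    exact congrArg (Ideal.Quotient.mk NegligibleAp) (ModerateAp.deriv.map_smul c u)

/-! ### Mollifiers -/

/-- The set `Σ` of Schwartz functions with integral `1` whose higher moments all vanish. -/
def SigmaSet : Set 𝓢(ℝ, ℂ) :=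
  {ρ | (∫ x : ℝ, ρ x) = 1 ∧ ∀ k : ℕ, 1 ≤ k → (∫ x : ℝ, (x : ℂ) ^ k * ρ x) = 0}

theorem schwartz_mem_dl1 (ρ : 𝓢(ℝ, ℂ)) : (ρ : ℝ → ℂ) ∈ dlpSubmodule 1 := by
  refine ⟨ρ.smooth', fun j => ?_⟩
  induction j generalizing ρ with
  | zero => simpa using ρ.memLp 1 volume
  | succ j ih =>
    have h := ih (SchwartzMap.derivCLM ℂ ℂ ρ)
    have e : ⇑(SchwartzMap.derivCLM ℂ ℂ ρ) = _root_.deriv ρ := by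
      funext x
      simp
    rw [e] at h
    rwa [iteratedDeriv_succ']

/-- The scaled function `ρ_ε = ε⁻¹ ρ(· / ε)`, as an element of `D_{L^1}`. -/
def scaled (ρ : 𝓢(ℝ, ℂ)) (ε : ParamI) : DLp 1 :=
  ⟨fun x => (1 / (ε : ℝ) : ℂ) * ρ (x / (ε : ℝ)), by
    have h := dl1_affine_mem (schwartz_mem_dl1 ρ) (a := (ε : ℝ)⁻¹) (inv_ne_zero ε.2.1.ne') 0
    have h2 := (dlpSubmodule 1).smul_mem (1 / (ε : ℝ) : ℂ) h
    convert h2 using 1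
    funext x
    simp [div_eq_inv_mul]⟩

end APGen

end

namespace APGen

/-! ### Taylor estimates in `L¹` -/

/-! Everything starts from continuity of `T` on `D_{L^1}`: a single norm controls it, `|T φ| ≤ C
|φ|_{m,1}` (`exists_bound`). These norms do not change under reflection and translation, so `T * φ`
is bounded, and a second-order Taylor estimate in `L^1` gives `(T * φ)' = T * φ'`. The map `T ↦ T *
φ` is continuous into the bounded continuous functions and intertwines translations, hence carries
relatively compact orbits to relatively compact orbits; thus `T * φ` lies in `B_ap`. Since
`|ρ_ε|_{k,1}` is at most `ε^{-k} |ρ|_{k,1}`, the mollified family is moderate.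

Injectivity rests on the symmetry `∫ φ(t) (T * ψ)(-t) dt = ∫ ψ(t) (T * φ)(-t) dt`
(`integral_mul_convDistr_comm`). With `φ = ρ_ε` the left side tends to `(T * ψ)(0)`, as `ρ` has
integral 1, while the right side is at most `‖ψ‖_1 ‖T * ρ_ε‖_∞`, which tends to 0 for a negligible
family. So `T` kills every reflected `ψ`, and `T = 0`.

The symmetry is proved without integrating in the Fréchet space `D_{L^1}`: by Hahn–Banach, `T`
factors through the jet `φ ↦ (φ, …, φ^{(m)})` into a finite product of `L^1` spaces. There Bochner
integrals commute with the functional, and what remains is commutativity of ordinary convolution. -/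

theorem lintegral_enorm_le_of_hasDerivAt {K K' : ℝ → ℝ → ℂ}
    (hK : ∀ t x, HasDerivAt (fun s => K s x) (K' t x) t) (hK' : Continuous (Function.uncurry K'))
    (h0 : ∀ x, K 0 x = 0) {h : ℝ} {M : ℝ≥0∞}
    (hM : ∀ t, |t| ≤ |h| → ∫⁻ x, ‖K' t x‖ₑ ≤ M) :
    ∫⁻ x, ‖K h x‖ₑ ≤ ENNReal.ofReal |h| * M := by
  have hcont : ∀ x, Continuous fun t => K' t x := fun x =>
    hK'.comp (continuous_id.prodMk continuous_const)
  have h1 : ∀ x, ‖K h x‖ₑ ≤ ∫⁻ t in Set.uIoc 0 h, ‖K' t x‖ₑ := by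
    intro x
    have e : ∫ t in (0 : ℝ)..h, K' t x = K h x := by
      rw [intervalIntegral.integral_eq_sub_of_hasDerivAt (fun t _ => hK t x)
        ((hcont x).intervalIntegrable _ _), h0, sub_zero]
    have h2 : ‖K h x‖ₑ = ‖∫ t in Set.uIoc 0 h, K' t x‖ₑ := by
      rw [← e, ← ofReal_norm, ← ofReal_norm, intervalIntegral.norm_intervalIntegral_eq]
    rw [h2]
    exact enorm_integral_le_lintegral_enorm _
  -- Tonelli exchanges the two integrals, so the bound on each time slice is integrated over an
  -- interval of length `|h|`.
  calc ∫⁻ x, ‖K h x‖ₑ ≤ ∫⁻ x, ∫⁻ t in Set.uIoc 0 h, ‖K' t x‖ₑ := lintegral_mono h1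
    _ = ∫⁻ t in Set.uIoc 0 h, ∫⁻ x, ‖K' t x‖ₑ := by
        refine lintegral_lintegral_swap ?_
        exact (hK'.comp continuous_swap).enorm.measurable.aemeasurable
    _ ≤ ∫⁻ _ in Set.uIoc 0 h, M := by
        refine setLIntegral_mono measurable_const fun t ht => hM t ?_
        rcases Set.mem_uIoc.1 ht with ⟨a, b⟩ | ⟨a, b⟩
        · rw [abs_of_pos a, abs_of_pos (a.trans_le b)]; exact b
        · rw [abs_of_nonpos b, abs_of_neg (a.trans_le b)]; linarith
    _ = ENNReal.ofReal |h| * M := by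
        rw [lintegral_const, Measure.restrict_apply_univ, Set.uIoc, Real.volume_Ioc, mul_comm]
        congr 2
        rw [max_sub_min_eq_abs, sub_zero]

theorem hasDerivAt_comp_const_add {f : ℝ → ℂ} (hf : Differentiable ℝ f) (x t : ℝ) :
    HasDerivAt (fun s => f (x + s)) (deriv f (x + t)) t :=
  (hf (x + t)).hasDerivAt.comp_const_add x t

theorem lintegral_enorm_translate_sub_le {f : ℝ → ℂ} (hf : ContDiff ℝ ∞ f) (h : ℝ) :
    ∫⁻ x, ‖f (x + h) - f x‖ₑ ≤ ENNReal.ofReal |h| * ∫⁻ x, ‖deriv f x‖ₑ := by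
  have hc : Continuous (deriv f) := hf.continuous_deriv (by simp)
  refine lintegral_enorm_le_of_hasDerivAt (K := fun t x => f (x + t) - f x)
    (K' := fun t x => deriv f (x + t)) (fun t x => ?_) ?_ (by simp) fun t _ => ?_
  · simpa using (hasDerivAt_comp_const_add (hf.differentiable (by simp)) x t).sub_const (f x)
  · exact hc.comp (continuous_snd.add continuous_fst)
  · exact (lintegral_add_right_eq_self (fun x => ‖deriv f x‖ₑ) t).le

/-- The remainder vanishes at `t = 0` and its `t`-derivative is the increment of `f'`, so the
first-order estimate for `f'` is integrated once more. -/
theorem lintegral_enorm_taylor_le {f : ℝ → ℂ} (hf : ContDiff ℝ ∞ f) (h : ℝ) :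
    ∫⁻ x, ‖f (x + h) - f x - h * deriv f x‖ₑ
      ≤ ENNReal.ofReal |h| * (ENNReal.ofReal |h| * ∫⁻ x, ‖deriv (deriv f) x‖ₑ) := by
  have hf' : ContDiff ℝ ∞ (deriv f) := (contDiff_infty_iff_deriv.1 hf).2
  have hc : Continuous (deriv f) := hf'.continuous
  refine lintegral_enorm_le_of_hasDerivAt (K := fun t x => f (x + t) - f x - t * deriv f x)
    (K' := fun t x => deriv f (x + t) - deriv f x) (fun t x => ?_) ?_ (by simp) fun t ht => ?_
  · have h1 := (hasDerivAt_comp_const_add (hf.differentiable (by simp)) x t).sub_const (f x)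
    have h2 : HasDerivAt (fun s : ℝ => (s : ℂ) * deriv f x) (1 * deriv f x) t :=
      (Complex.ofRealCLM.hasDerivAt (x := t)).mul_const (deriv f x)
    rw [one_mul] at h2
    exact h1.sub h2
  · exact (hc.comp (continuous_snd.add continuous_fst)).sub (hc.comp continuous_snd)
  · refine (lintegral_enorm_translate_sub_le hf' t).trans ?_
    gcongr

/-! ### Elements of `D_{L^p}` and functionals on `D_{L^1}` -/

theorem DLp.ext {p : ℝ≥0∞} {φ ψ : DLp p} (h : ∀ x, φ x = ψ x) : φ = ψ :=
  Subtype.ext (funext h)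

theorem dlp_iteratedDeriv_mem {p : ℝ≥0∞} {f : ℝ → ℂ} (hf : f ∈ dlpSubmodule p) (j : ℕ) :
    iteratedDeriv j f ∈ dlpSubmodule p := by
  induction j with
  | zero => simpa using hf
  | succ j ih => rw [iteratedDeriv_succ]; exact dlp_deriv_mem ih

theorem dlpNorm_mono (p : ℝ≥0∞) {k l : ℕ} (h : k ≤ l) (f : ℝ → ℂ) :
    dlpNorm p k f ≤ dlpNorm p l f :=
  Finset.sum_le_sum_of_subset_of_nonneg (Finset.range_mono (by omega))
    fun _ _ _ => ENNReal.toReal_nonneg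

/-- Continuity yields a finite supremum of seminorms; they increase with the index, so the largest
index suffices. -/
theorem exists_bound (T : BoundedDistribution) :
    ∃ (m : ℕ) (C : ℝ), 0 < C ∧ ∀ φ : DLp 1, ‖T φ‖ ≤ C * dlpNorm 1 m φ := by
  obtain ⟨s, C, hC, h⟩ := Seminorm.bound_of_continuous (dlp_withSeminorms 1)
    ((normSeminorm ℂ ℂ).comp T.toLinearMap) (continuous_norm.comp T.continuous)
  refine ⟨s.sup id, C, by positivity, fun φ => (h φ).trans ?_⟩
  rw [smul_apply, NNReal.smul_def, smul_eq_mul]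
  refine mul_le_mul_of_nonneg_left ?_ C.2
  refine Seminorm.finset_sup_apply_le (dlpNorm_nonneg _ _ _) fun i hi => ?_
  exact dlpNorm_mono 1 (Finset.le_sup (f := id) hi) _

theorem iteratedDeriv_reflectAt (φ : DLp 1) (x : ℝ) (j : ℕ) :
    iteratedDeriv j (φ.reflectAt x) = fun y => (-1) ^ j * iteratedDeriv j φ (x - y) := by
  have := iteratedDeriv_comp_const_sub j (φ : ℝ → ℂ) x
  refine Eq.trans this (funext fun y => ?_)
  rcases neg_one_pow_eq_or ℝ j with h | h <;> rcases Nat.even_or_odd j with h' | h' <;>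
    simp [h'.neg_one_pow]

theorem dlpNorm_reflectAt (φ : DLp 1) (x : ℝ) (k : ℕ) :
    dlpNorm 1 k (φ.reflectAt x) = dlpNorm 1 k φ := by
  unfold dlpNorm
  refine Finset.sum_congr rfl fun j _ => ?_
  rw [iteratedDeriv_reflectAt]
  have e : eLpNorm (iteratedDeriv j φ ∘ fun y => x - y) 1 volume
      = eLpNorm (iteratedDeriv j φ) 1 volume :=
    eLpNorm_comp_measurePreserving (φ.2.2 j).1 (volume.measurePreserving_sub_left x)
  rw [← e]
  congr 1
  refine eLpNorm_congr_norm_ae (Eventually.of_forall fun y => ?_)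
  simp

theorem norm_convDistr_le {T : BoundedDistribution} {m : ℕ} {C : ℝ}
    (hT : ∀ φ : DLp 1, ‖T φ‖ ≤ C * dlpNorm 1 m φ) (φ : DLp 1) (x : ℝ) :
    ‖convDistr T φ x‖ ≤ C * dlpNorm 1 m φ :=
  (hT (φ.reflectAt x)).trans_eq (by rw [dlpNorm_reflectAt])

/-- Differentiation commutes with forming the Taylor remainder, so the `L^1` estimate applies to
each `f^{(j)}`, at the cost of two derivatives. -/
theorem dlpNorm_taylor_le {f : ℝ → ℂ} (hf : f ∈ dlpSubmodule 1) (h : ℝ) (k : ℕ) :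
    dlpNorm 1 k (fun x => f (x + h) - f x - h * deriv f x) ≤ |h| ^ 2 * dlpNorm 1 (k + 2) f := by
  have h2 : dlpNorm 1 k (deriv (deriv f)) ≤ dlpNorm 1 (k + 2) f :=
    (dlpNorm_deriv_le _ _ _).trans (dlpNorm_deriv_le _ _ _)
  refine le_trans ?_ (mul_le_mul_of_nonneg_left h2 (by positivity))
  unfold dlpNorm
  rw [Finset.mul_sum]
  refine Finset.sum_le_sum fun j _ => ?_
  have e : iteratedDeriv j (fun x => f (x + h) - f x - h * deriv f x)
      = fun x => iteratedDeriv j f (x + h) - iteratedDeriv j f x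
        - h * deriv (iteratedDeriv j f) x := by
    have e1 : (fun x => f (x + h) - f x - h * deriv f x)
        = ((fun x => f (x + h)) + (-1 : ℂ) • f) + (-h : ℂ) • deriv f := by
      funext x
      simp only [Pi.add_apply, Pi.smul_apply, smul_eq_mul]
      ring
    have m1 := dlp_translate_mem hf h
    have m2 := (dlpSubmodule 1).smul_mem (-1) hf
    have m3 := (dlpSubmodule 1).smul_mem (-h : ℂ) (dlp_deriv_mem hf)
    rw [e1, dlp_iteratedDeriv_add (add_mem m1 m2) m3, dlp_iteratedDeriv_add m1 m2,
      iteratedDeriv_smul_fun, iteratedDeriv_smul_fun, iteratedDeriv_translate,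
      ← iteratedDeriv_succ', iteratedDeriv_succ]
    funext x
    simp only [Pi.add_apply, Pi.smul_apply, smul_eq_mul]
    ring
  have hj := dlp_iteratedDeriv_mem hf j
  have e3 : iteratedDeriv j (deriv (deriv f)) = deriv (deriv (iteratedDeriv j f)) := by
    rw [← iteratedDeriv_succ', ← iteratedDeriv_succ', iteratedDeriv_succ, iteratedDeriv_succ]
  rw [e, e3, eLpNorm_one_eq_lintegral_enorm, eLpNorm_one_eq_lintegral_enorm]
  -- Finiteness matters because `toReal` sends `⊤` to 0 and is monotone only below finite bounds.
  have hfin : ∫⁻ x, ‖deriv (deriv (iteratedDeriv j f)) x‖ₑ ≠ ⊤ := by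
    rw [← eLpNorm_one_eq_lintegral_enorm]
    have := (dlp_deriv_mem (dlp_deriv_mem hj)).2 0
    rw [iteratedDeriv_zero] at this
    exact this.eLpNorm_ne_top
  refine (ENNReal.toReal_mono ?_ (lintegral_enorm_taylor_le hj.1 h)).trans ?_
  · exact ENNReal.mul_ne_top ENNReal.ofReal_ne_top (ENNReal.mul_ne_top ENNReal.ofReal_ne_top hfin)
  · rw [ENNReal.toReal_mul, ENNReal.toReal_mul, ENNReal.toReal_ofReal (abs_nonneg h), ← mul_assoc,
      sq]

/-! ### Convolution of a bounded distribution with a function -/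

/-- The error in the difference quotient is `T` convolved with the Taylor remainder of `φ`, hence
`O(h^2)`. -/
theorem hasDerivAt_convDistr (T : BoundedDistribution) (φ : DLp 1) (x : ℝ) :
    HasDerivAt (convDistr T φ) (convDistr T (DLp.derivLM 1 φ) x) x := by
  obtain ⟨m, C, hC, hT⟩ := exists_bound T
  rw [hasDerivAt_iff_isLittleO_nhds_zero]
  have hO : (fun h : ℝ => convDistr T φ (x + h) - convDistr T φ x
      - h • convDistr T (DLp.derivLM 1 φ) x) =O[𝓝 0] fun h : ℝ => h ^ 2 := by
    refine Asymptotics.IsBigO.of_bound (C * dlpNorm 1 (m + 2) φ) (Eventually.of_forall fun h => ?_)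
    have e : convDistr T φ (x + h) - convDistr T φ x - h • convDistr T (DLp.derivLM 1 φ) x
        = convDistr T (DLp.shiftLM 1 h φ - φ - (h : ℂ) • DLp.derivLM 1 φ) x := by
      have : (DLp.shiftLM 1 h φ - φ - (h : ℂ) • DLp.derivLM 1 φ).reflectAt x
          = φ.reflectAt (x + h) - φ.reflectAt x - (h : ℂ) • (DLp.derivLM 1 φ).reflectAt x := by
        refine DLp.ext fun y => ?_
        show φ (x - y + h) - φ (x - y) - h * deriv φ (x - y)
          = φ (x + h - y) - φ (x - y) - h * deriv φ (x - y)
        rw [sub_add_eq_add_sub]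
      unfold convDistr
      rw [this, map_sub, map_sub, map_smul]
      simp
    rw [e]
    refine (norm_convDistr_le hT _ x).trans ?_
    refine (mul_le_mul_of_nonneg_left (dlpNorm_taylor_le φ.2 h m) hC.le).trans (le_of_eq ?_)
    rw [norm_pow, Real.norm_eq_abs, mul_left_comm, mul_comm]
    rfl
  refine hO.trans_isLittleO ?_
  simpa using Asymptotics.isLittleO_pow_pow (𝕜 := ℝ) (show 1 < 2 by norm_num)

theorem deriv_convDistr (T : BoundedDistribution) (φ : DLp 1) :
    deriv (convDistr T φ) = convDistr T (DLp.derivLM 1 φ) :=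
  funext fun x => (hasDerivAt_convDistr T φ x).deriv

theorem iteratedDeriv_convDistr (T : BoundedDistribution) (φ : DLp 1) (j : ℕ) :
    iteratedDeriv j (convDistr T φ) = convDistr T ((DLp.derivLM 1 ^ j) φ) := by
  induction j generalizing φ with
  | zero => rw [iteratedDeriv_zero]; rfl
  | succ j ih => rw [iteratedDeriv_succ', deriv_convDistr, ih, pow_succ]; rfl

theorem contDiff_convDistr (T : BoundedDistribution) (φ : DLp 1) :
    ContDiff ℝ ∞ (convDistr T φ) := by
  refine contDiff_of_differentiable_iteratedDeriv fun j _ => ?_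
  rw [iteratedDeriv_convDistr]
  exact fun x => (hasDerivAt_convDistr T _ x).differentiableAt

theorem continuous_convDistr (T : BoundedDistribution) (φ : DLp 1) :
    Continuous (convDistr T φ) :=
  (contDiff_convDistr T φ).continuous

theorem exists_norm_convDistr_le (T : BoundedDistribution) (φ : DLp 1) :
    ∃ C, ∀ x, ‖convDistr T φ x‖ ≤ C :=
  let ⟨_, _, _, hT⟩ := exists_bound T
  ⟨_, norm_convDistr_le hT φ⟩

/-- The map `T ↦ T * φ` from bounded distributions to bounded continuous functions. -/
noncomputable def convBCF (φ : DLp 1) : BoundedDistribution →ₗ[ℂ] (ℝ →ᵇ ℂ) where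
  toFun T := BoundedContinuousFunction.ofNormedAddCommGroup (convDistr T φ)
    (continuous_convDistr T φ) _ (exists_norm_convDistr_le T φ).choose_spec
  map_add' _ _ := rfl
  map_smul' _ _ := rfl

/-- The sup norm of `T * φ` is the supremum of `|T|` on the functions `φ(x - ·)`. Each norm is
constant on this set, so the set is bounded, and the strong topology controls suprema over bounded
sets. -/
theorem continuous_convBCF (φ : DLp 1) : Continuous (convBCF φ) := by
  refine continuous_of_continuousAt_zero (convBCF φ) ?_
  rw [ContinuousAt, map_zero, ContinuousLinearMap.hasBasis_nhds_zero.tendsto_iff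
    Metric.nhds_basis_closedBall]
  intro r hr
  refine ⟨(Set.range φ.reflectAt, Metric.closedBall 0 r), ⟨?_, Metric.closedBall_mem_nhds _ hr⟩, ?_⟩
  · refine (dlp_withSeminorms 1).isVonNBounded_iff_seminorm_bounded.2 fun k => ?_
    -- The criterion wants a positive bound and a strict inequality, hence the `+ 1`.
    refine ⟨dlpNorm 1 k φ + 1, by linarith [dlpNorm_nonneg 1 k φ], ?_⟩
    rintro _ ⟨x, rfl⟩
    show dlpNorm 1 k (φ.reflectAt x) < _
    rw [dlpNorm_reflectAt]
    linarith
  · intro T hT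
    rw [mem_closedBall_zero_iff, BoundedContinuousFunction.norm_le hr.le]
    intro x
    exact mem_closedBall_zero_iff.1 (hT _ ⟨x, rfl⟩)

theorem translateBCF_convBCF (T : BoundedDistribution) (φ : DLp 1) (h : ℝ) :
    translateBCF (convBCF φ T) h = convBCF φ (translateDistr (-h) T) := by
  ext x
  show T (φ.reflectAt (x + h)) = T (DLp.shiftCLM 1 (-h) (φ.reflectAt x))
  congr 1
  refine DLp.ext fun y => ?_
  show φ (x + h - y) = φ (x - (y + -h))
  congr 1
  ring

/-- All translates of `T * φ` lie in the continuous image of the compact orbit closure of `T`;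
compactness in a metric space gives the subsequence. -/
theorem isAlmostPeriodicFun_convDistr {T : BoundedDistribution} (hT : T ∈ apDistributions)
    (φ : DLp 1) : IsAlmostPeriodicFun (convDistr T φ) := by
  refine ⟨convBCF φ T, rfl, fun h => ?_⟩
  have hK : IsCompact _ := (hT : IsCompact _).image (continuous_convBCF φ)
  obtain ⟨G, -, s, hs, hG⟩ := hK.tendsto_subseq (x := fun n => translateBCF (convBCF φ T) (h n))
    fun n => ⟨translateDistr (-h n) T, subset_closure ⟨_, rfl⟩, (translateBCF_convBCF T φ _).symm⟩
  exact ⟨s, hs, G, hG⟩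

theorem memLp_top_convDistr (T : BoundedDistribution) (φ : DLp 1) :
    MemLp (convDistr T φ) ∞ volume :=
  let ⟨C, hC⟩ := exists_norm_convDistr_le T φ
  memLp_top_of_bound (continuous_convDistr T φ).aestronglyMeasurable C (Eventually.of_forall hC)

theorem convDistr_mem_Bap {T : BoundedDistribution} (hT : T ∈ apDistributions) (φ : DLp 1) :
    convDistr T φ ∈ Bap := by
  refine ⟨⟨contDiff_convDistr T φ, fun j => ?_⟩, fun j => ?_⟩
  · rw [iteratedDeriv_convDistr]; exact memLp_top_convDistr T _
  · rw [iteratedDeriv_convDistr]; exact isAlmostPeriodicFun_convDistr hT _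

theorem derivLM_pow_apply (φ : DLp 1) (j : ℕ) :
    ((DLp.derivLM 1 ^ j) φ).toFun = iteratedDeriv j φ := by
  induction j with
  | zero => rw [iteratedDeriv_zero]; rfl
  | succ j ih => rw [iteratedDeriv_succ, ← ih, pow_succ']; rfl

theorem dlpNorm_iteratedDeriv_le (p : ℝ≥0∞) (k j : ℕ) (f : ℝ → ℂ) :
    dlpNorm p k (iteratedDeriv j f) ≤ dlpNorm p (k + j) f := by
  induction j generalizing k with
  | zero => simp
  | succ j ih =>
    rw [iteratedDeriv_succ]
    exact (dlpNorm_deriv_le _ _ _).trans ((ih _).trans_eq (by congr 1; ring))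

theorem dlpNorm_convDistr_le {T : BoundedDistribution} {m : ℕ} {C : ℝ} (hC : 0 ≤ C)
    (hT : ∀ φ : DLp 1, ‖T φ‖ ≤ C * dlpNorm 1 m φ) (φ : DLp 1) (k : ℕ) :
    dlpNorm ∞ k (convDistr T φ) ≤ (k + 1) * (C * dlpNorm 1 (m + k) φ) := by
  have h0 : 0 ≤ C * dlpNorm 1 (m + k) φ := mul_nonneg hC (dlpNorm_nonneg _ _ _)
  calc dlpNorm ∞ k (convDistr T φ)
      ≤ ∑ _j ∈ Finset.range (k + 1), C * dlpNorm 1 (m + k) φ := by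
        refine Finset.sum_le_sum fun j hj => ?_
        have hjk : j ≤ k := by simpa [Nat.lt_succ_iff] using hj
        refine ENNReal.toReal_le_of_le_ofReal h0 ?_
        refine eLpNormEssSup_le_of_ae_bound (Eventually.of_forall fun x => ?_)
        rw [iteratedDeriv_convDistr]
        refine (norm_convDistr_le hT _ x).trans (mul_le_mul_of_nonneg_left ?_ hC)
        rw [derivLM_pow_apply]
        exact (dlpNorm_iteratedDeriv_le _ _ _ _).trans (dlpNorm_mono _ (by omega) _)
    _ = _ := by simp

/-! ### The mollified families are moderate -/

theorem eLpNorm_iteratedDeriv_scaled (ρ : 𝓢(ℝ, ℂ)) (ε : ParamI) (j : ℕ) :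
    (eLpNorm (iteratedDeriv j (scaled ρ ε)) 1 volume).toReal
      = (ε : ℝ)⁻¹ ^ j * (eLpNorm (iteratedDeriv j ρ) 1 volume).toReal := by
  have hε : (0 : ℝ) < ε := ε.2.1
  have e : (scaled ρ ε).toFun = ((ε : ℝ)⁻¹ : ℂ) • fun x => ρ ((ε : ℝ)⁻¹ * x) := by
    funext x
    simp [scaled, DLp.toFun, div_eq_inv_mul]
  have hρ : ContDiff ℝ j ρ := (schwartz_mem_dl1 ρ).1.of_le (by exact_mod_cast le_top)
  rw [e, iteratedDeriv_smul_fun, iteratedDeriv_comp_const_smul hρ, eLpNorm_const_smul,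
    ENNReal.toReal_mul, toReal_enorm]
  have e2 : (fun x => (ε : ℝ)⁻¹ ^ j • iteratedDeriv j ρ ((ε : ℝ)⁻¹ * x))
      = ((ε : ℝ)⁻¹ ^ j) • fun x => iteratedDeriv j ρ ((ε : ℝ)⁻¹ * x) := rfl
  -- The linear change of variables is made in the Bochner integral of the norm.
  have hi : ∀ f : ℝ → ℂ, MemLp f 1 volume →
      (eLpNorm f 1 volume).toReal = ∫ x, ‖f x‖ := fun f hf => by
    rw [eLpNorm_one_eq_lintegral_enorm, integral_norm_eq_lintegral_enorm hf.1]
  have hm := (schwartz_mem_dl1 ρ).2 j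
  have hm2 : MemLp (fun x => iteratedDeriv j ρ ((ε : ℝ)⁻¹ * x)) 1 volume :=
    memLp_one_iff_integrable.2
      ((memLp_one_iff_integrable.1 hm).comp_mul_left' (inv_ne_zero hε.ne'))
  rw [e2, eLpNorm_const_smul, ENNReal.toReal_mul, toReal_enorm, hi _ hm, hi _ hm2,
    Measure.integral_comp_mul_left (fun x => ‖iteratedDeriv j ρ x‖)]
  simp only [norm_inv, Complex.norm_real, Real.norm_eq_abs, norm_pow, inv_inv, smul_eq_mul,
    abs_of_pos hε]
  field_simp

theorem dlpNorm_scaled_le (ρ : 𝓢(ℝ, ℂ)) (ε : ParamI) (k : ℕ) :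
    dlpNorm 1 k (scaled ρ ε) ≤ dlpNorm 1 k ρ * (ε : ℝ) ^ (-(k : ℤ)) := by
  have hε : (0 : ℝ) < ε := ε.2.1
  unfold dlpNorm
  rw [Finset.sum_mul]
  refine Finset.sum_le_sum fun j hj => ?_
  rw [eLpNorm_iteratedDeriv_scaled, mul_comm, zpow_neg, zpow_natCast, ← inv_pow]
  refine mul_le_mul_of_nonneg_left ?_ ENNReal.toReal_nonneg
  -- As `ε ≤ 1`, the highest power `ε^{-k}` dominates all `ε^{-j}` with `j ≤ k`.
  exact pow_le_pow_right₀ ((one_le_inv₀ hε).2 ε.2.2) (Nat.lt_succ_iff.1 (Finset.mem_range.1 hj))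

/-- The moderate family `(u * ρ_ε)_ε`. -/
noncomputable def mollify (ρ : 𝓢(ℝ, ℂ)) : apDistributions →ₗ[ℂ] ModerateAp where
  toFun u := ⟨fun ε => ⟨convDistr u (scaled ρ ε), convDistr_mem_Bap u.2 _⟩, fun k => by
    obtain ⟨m, C, hC, hT⟩ := exists_bound u
    -- The order `m` of `T` and the `k` derivatives falling on `ρ_ε` add up.
    refine ⟨m + k, Asymptotics.IsBigO.of_bound ((k + 1) * (C * dlpNorm 1 (m + k) ρ))
      (Eventually.of_forall fun ε => ?_)⟩
    rw [Real.norm_of_nonneg (dlpNorm_nonneg _ _ _), Real.norm_of_nonneg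
      (zpow_nonneg ε.2.1.le _), mul_assoc, mul_assoc]
    refine (dlpNorm_convDistr_le hC.le hT _ k).trans ?_
    have := dlpNorm_scaled_le ρ ε (m + k)
    gcongr⟩
  map_add' _ _ := rfl
  map_smul' _ _ := rfl

/-- The sign in the definition of `T'` cancels the one from differentiating `y ↦ φ(x - y)`. -/
theorem convDistr_derivDistr (T : BoundedDistribution) (φ : DLp 1) :
    convDistr (derivDistr T) φ = deriv (convDistr T φ) := by
  rw [deriv_convDistr]
  funext x
  show -T (DLp.derivCLM 1 (φ.reflectAt x)) = T ((DLp.derivLM 1 φ).reflectAt x)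
  rw [← map_neg]
  congr 1
  refine DLp.ext fun y => ?_
  show -deriv (fun y => φ (x - y)) y = deriv φ (x - y)
  rw [deriv_comp_const_sub, neg_neg]

theorem mollify_derivAp (ρ : 𝓢(ℝ, ℂ)) (u : apDistributions) :
    mollify ρ (derivAp u) = ModerateAp.deriv (mollify ρ u) :=
  Subtype.ext (funext fun ε => Subtype.ext (convDistr_derivDistr u (scaled ρ ε)))

/-! ### Reflected translates as a curve in `L¹` -/

theorem dl1_integrable {f : ℝ → ℂ} (hf : f ∈ dlpSubmodule 1) : Integrable f :=
  memLp_one_iff_integrable.1 (by simpa using hf.2 0)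

theorem dl1_memLp_reflect {f : ℝ → ℂ} (hf : f ∈ dlpSubmodule 1) (t : ℝ) :
    MemLp (fun y => f (-t - y)) 1 volume :=
  memLp_one_iff_integrable.2 ((dl1_integrable hf).comp_sub_left (-t))

/-- The class of `y ↦ f(-t - y)` in `L¹`. -/
noncomputable def reflectL1 {f : ℝ → ℂ} (hf : f ∈ dlpSubmodule 1) (t : ℝ) :
    Lp ℂ 1 (volume : Measure ℝ) :=
  (dl1_memLp_reflect hf t).toLp

/-- The increments of `f` are bounded by the integral of `|f'|`. Boundedness makes the products in
the integrations by parts integrable. -/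
theorem dl1_exists_bound {f : ℝ → ℂ} (hf : f ∈ dlpSubmodule 1) : ∃ C, ∀ x, ‖f x‖ ≤ C := by
  have hi : Integrable (deriv f) := dl1_integrable (dlp_deriv_mem hf)
  refine ⟨‖f 0‖ + ∫ x, ‖deriv f x‖, fun x => ?_⟩
  have e : ∫ t in (0 : ℝ)..x, deriv f t = f x - f 0 :=
    intervalIntegral.integral_eq_sub_of_hasDerivAt
      (fun t _ => (hf.1.differentiable (by simp) t).hasDerivAt) hi.intervalIntegrable
  have h1 : ‖f x - f 0‖ ≤ ∫ x, ‖deriv f x‖ := by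
    rw [← e]
    exact intervalIntegral.norm_integral_le_integral_norm_uIoc.trans
      (setIntegral_le_integral hi.norm (Eventually.of_forall fun _ => norm_nonneg _))
  calc ‖f x‖ = ‖f 0 + (f x - f 0)‖ := by rw [add_sub_cancel]
    _ ≤ _ := (norm_add_le _ _).trans (by gcongr)

/-- The first-order translation estimate makes the curve Lipschitz with constant `‖f'‖_1`. -/
theorem continuous_reflectL1 {f : ℝ → ℂ} (hf : f ∈ dlpSubmodule 1) :
    Continuous (reflectL1 hf) := by
  have hfin : ∫⁻ x, ‖deriv f x‖ₑ ≠ ⊤ := (dl1_integrable (dlp_deriv_mem hf)).2.ne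
  refine LipschitzWith.continuous (K := (∫⁻ x, ‖deriv f x‖ₑ).toNNReal) fun s t => ?_
  rw [reflectL1, reflectL1, Lp.edist_toLp_toLp, eLpNorm_one_eq_lintegral_enorm,
    ENNReal.coe_toNNReal hfin, edist_dist, dist_comm, Real.dist_eq, mul_comm]
  refine le_trans (le_of_eq ?_) (lintegral_enorm_translate_sub_le hf.1 (t - s))
  rw [← lintegral_sub_left_eq_self (fun x => ‖f (x + (t - s)) - f x‖ₑ) (-t)]
  refine lintegral_congr fun y => ?_
  simp only [Pi.sub_apply]
  congr 3
  ring

theorem norm_reflectL1 {f : ℝ → ℂ} (hf : f ∈ dlpSubmodule 1) (t : ℝ) :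
    ‖reflectL1 hf t‖ = ∫ y, ‖f y‖ := by
  rw [reflectL1, Lp.norm_toLp, eLpNorm_one_eq_lintegral_enorm,
    ← integral_norm_eq_lintegral_enorm (dl1_memLp_reflect hf t).1]
  exact integral_sub_left_eq_self (fun y => ‖f y‖) volume (-t)

theorem integrable_smul_reflectL1 {f g : ℝ → ℂ} (hf : Integrable f) (hg : g ∈ dlpSubmodule 1) :
    Integrable fun t => f t • reflectL1 hg t :=
  hf.smul_bdd (∫ y, ‖g y‖) (continuous_reflectL1 hg).aestronglyMeasurable
    (Eventually.of_forall fun t => (norm_reflectL1 hg t).le)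

theorem integrable_mul_reflect {f g : ℝ → ℂ} (hf : Integrable f) (hg : Integrable g) :
    Integrable (fun p : ℝ × ℝ => f p.2 * g (-p.2 - p.1)) (volume.prod volume) := by
  have h1 := hf.convolution_integrand (ContinuousLinearMap.mul ℂ ℂ) (μ := volume) hg
  have h2 : MeasurePreserving (Prod.map (fun y : ℝ => -y) (id : ℝ → ℝ))
      (volume.prod volume) (volume.prod volume) :=
    (Measure.measurePreserving_neg volume).prod (MeasurePreserving.id volume)
  refine (h2.integrable_comp_of_integrable h1).congr (Eventually.of_forall fun p => ?_)
  show f p.2 * g (-p.1 - p.2) = _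
  congr 2
  ring

/-- Integration over a measurable set `A` is a continuous functional on `L^1`, so it passes under
the Bochner integral; Fubini then shows that both sides have the same integral over every `A`. -/
theorem integral_smul_reflectL1_ae_eq {f g : ℝ → ℂ} (hf : Integrable f)
    (hg : g ∈ dlpSubmodule 1) :
    (∫ t, f t • reflectL1 hg t : Lp ℂ 1 (volume : Measure ℝ))
      =ᵐ[volume] fun y => ∫ t, f t * g (-t - y) := by
  have hprod := integrable_mul_reflect hf (dl1_integrable hg)
  refine Integrable.ae_eq_of_forall_setIntegral_eq _ _ (L1.integrable_coeFn _)
    hprod.integral_prod_left fun A _ _ => ?_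
  let L : Lp ℂ 1 (volume : Measure ℝ) →L[ℂ] ℂ :=
    { toFun := fun u => ∫ y in A, u y
      map_add' := fun u v => by
        rw [← integral_add (L1.integrable_coeFn u).integrableOn (L1.integrable_coeFn v).integrableOn]
        exact integral_congr_ae (ae_restrict_of_ae (Lp.coeFn_add u v))
      map_smul' := fun c u => by
        rw [RingHom.id_apply, ← integral_smul]
        exact integral_congr_ae (ae_restrict_of_ae (Lp.coeFn_smul c u))
      cont := continuous_setIntegral A }
  have hL : ∀ t, L (reflectL1 hg t) = ∫ y in A, g (-t - y) := fun t =>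
    integral_congr_ae (ae_restrict_of_ae (MemLp.coeFn_toLp _))
  calc ∫ y in A, (∫ t, f t • reflectL1 hg t : Lp ℂ 1 (volume : Measure ℝ)) y
      = ∫ t, L (f t • reflectL1 hg t) :=
        (L.integral_comp_comm (integrable_smul_reflectL1 hf hg)).symm
    _ = ∫ t, ∫ y in A, f t * g (-t - y) := by
        simp only [map_smul, hL, smul_eq_mul, integral_const_mul]
    _ = ∫ y in A, ∫ t, f t * g (-t - y) := by
        refine integral_integral_swap (f := fun t y => f t * g (-t - y)) ?_
        have := hprod.swap.mono_measure
          (Measure.prod_mono le_rfl (Measure.restrict_le_self (s := A)))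
        exact this

theorem integrable_mul_comp_sub {f g : ℝ → ℂ} (hf : f ∈ dlpSubmodule 1)
    (hg : g ∈ dlpSubmodule 1) (s : ℝ) : Integrable fun t => f t * g (s - t) :=
  let ⟨_, hC⟩ := dl1_exists_bound hf
  ((dl1_integrable hg).comp_sub_left s).bdd_mul hf.1.continuous.aestronglyMeasurable
    (Eventually.of_forall hC)

theorem integral_mul_deriv_comp_sub {f g : ℝ → ℂ} (hf : f ∈ dlpSubmodule 1)
    (hg : g ∈ dlpSubmodule 1) (s : ℝ) :
    ∫ t, f t * deriv g (s - t) = ∫ t, deriv f t * g (s - t) := by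
  have h := integral_mul_deriv_eq_deriv_mul_of_integrable (u := f) (v := fun t => g (s - t))
    (u' := deriv f) (v' := fun t => -deriv g (s - t))
    (fun t _ => (hf.1.differentiable (by simp) t).hasDerivAt)
    (fun t _ => (hg.1.differentiable (by simp) (s - t)).hasDerivAt.comp_const_sub s t)
    (by simpa [Pi.mul_def] using (integrable_mul_comp_sub hf (dlp_deriv_mem hg) s).neg)
    (integrable_mul_comp_sub (dlp_deriv_mem hf) hg s) (integrable_mul_comp_sub hf hg s)
  simp only [mul_neg, integral_neg] at h
  exact neg_injective h

theorem integral_mul_iteratedDeriv_comp_sub {f g : ℝ → ℂ} (hf : f ∈ dlpSubmodule 1)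
    (hg : g ∈ dlpSubmodule 1) (s : ℝ) (j : ℕ) :
    ∫ t, f t * iteratedDeriv j g (s - t) = ∫ t, g t * iteratedDeriv j f (s - t) := by
  have h : ∫ t, f t * iteratedDeriv j g (s - t) = ∫ t, iteratedDeriv j f t * g (s - t) := by
    induction j generalizing f with
    | zero => simp
    | succ j ih =>
      rw [iteratedDeriv_succ, iteratedDeriv_succ',
        integral_mul_deriv_comp_sub hf (dlp_iteratedDeriv_mem hg j), ih (dlp_deriv_mem hf)]
  rw [h, ← integral_sub_left_eq_self _ volume s]
  simp [mul_comm]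

/-! ### Factorisation through a product of `L¹` spaces -/

/-- The bound makes `T` vanish on the kernel of `J`, so `T` descends to a bounded functional on the
range, which Hahn–Banach extends. -/
theorem exists_continuousLinearMap_comp_eq {V E : Type*} [AddCommGroup V] [Module ℂ V]
    [NormedAddCommGroup E] [NormedSpace ℂ E] (J : V →ₗ[ℂ] E) (T : V →ₗ[ℂ] ℂ) {C : ℝ}
    (h : ∀ v, ‖T v‖ ≤ C * ‖J v‖) : ∃ Λ : E →L[ℂ] ℂ, ∀ v, Λ (J v) = T v := by
  -- Any algebraic section will do: two preimages of a point differ by an element of the kernel,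
  -- where `T` is zero.
  obtain ⟨s, hs⟩ := J.rangeRestrict.exists_rightInverse_of_surjective J.range_rangeRestrict
  have hs' : ∀ x, J (s x) = x := fun x => congrArg Subtype.val (LinearMap.congr_fun hs x)
  obtain ⟨Λ, hΛ, -⟩ := exists_extension_norm_eq (LinearMap.range J)
    ((T.comp s).mkContinuous C fun x => (h (s x)).trans_eq (by rw [hs']; rfl))
  refine ⟨Λ, fun v => ?_⟩
  have h1 : Λ (J v) = T (s (J.rangeRestrict v)) := hΛ (J.rangeRestrict v)
  have h2 : T (s (J.rangeRestrict v) - v) = 0 := by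
    refine norm_le_zero_iff.1 ((h _).trans_eq ?_)
    rw [map_sub, hs', LinearMap.rangeRestrict, LinearMap.codRestrict_apply, sub_self, norm_zero,
      mul_zero]
  rw [h1, ← sub_eq_zero, ← map_sub, h2]

/-- The classes of the derivatives up to order `m` of an element of `D_{L^1}`. -/
noncomputable def jetL1 (m : ℕ) : DLp 1 →ₗ[ℂ] (Fin (m + 1) → Lp ℂ 1 (volume : Measure ℝ)) where
  toFun φ i := (φ.2.2 i).toLp
  map_add' φ ψ := funext fun i => by
    rw [Pi.add_apply, ← MemLp.toLp_add]
    exact MemLp.toLp_congr _ _ (Eventually.of_forall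
      (congrFun (dlp_iteratedDeriv_add φ.2 ψ.2 i)))
  map_smul' c φ := funext fun i => by
    rw [Pi.smul_apply, RingHom.id_apply, ← MemLp.toLp_const_smul]
    exact MemLp.toLp_congr _ _ (Eventually.of_forall
      (congrFun (iteratedDeriv_smul_fun c φ.1 i)))

theorem dlpNorm_le_norm_jetL1 (m : ℕ) (φ : DLp 1) :
    dlpNorm 1 m φ ≤ (m + 1) * ‖jetL1 m φ‖ := by
  unfold dlpNorm
  rw [Finset.sum_range]
  refine (Finset.sum_le_card_nsmul _ _ ‖jetL1 m φ‖ fun i _ => ?_).trans_eq (by simp)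
  exact (Lp.norm_toLp _ (φ.2.2 i)).symm.trans_le (norm_le_pi_norm (jetL1 m φ) i)

theorem iteratedDeriv_smul_mem {φ : ℝ → ℂ} (hφ : φ ∈ dlpSubmodule 1) (j : ℕ) :
    ((-1 : ℂ) ^ j) • iteratedDeriv j φ ∈ dlpSubmodule 1 :=
  (dlpSubmodule 1).smul_mem _ (dlp_iteratedDeriv_mem hφ j)

theorem jetL1_reflectAt (m : ℕ) (φ : DLp 1) (t : ℝ) (i : Fin (m + 1)) :
    jetL1 m (φ.reflectAt (-t)) i = reflectL1 (iteratedDeriv_smul_mem φ.2 i) t :=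
  MemLp.toLp_congr ((φ.reflectAt (-t)).2.2 i) _
    (Eventually.of_forall (congrFun (iteratedDeriv_reflectAt φ (-t) i)))

/-- Both sides are `Λ` of a Bochner integral of jets. Its `i`-th component is `(-1)^i (φ *
ψ^{(i)})(-y)`, and derivatives may be moved between the factors of a convolution, so it is symmetric
in `φ` and `ψ`. -/
theorem integral_mul_convDistr_comm (T : BoundedDistribution) (φ ψ : DLp 1) :
    ∫ t, φ t * convDistr T ψ (-t) = ∫ t, ψ t * convDistr T φ (-t) := by
  obtain ⟨m, C, hC, hT⟩ := exists_bound T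
  obtain ⟨Λ, hΛ⟩ := exists_continuousLinearMap_comp_eq (jetL1 m) T.toLinearMap
    (C := C * (m + 1)) fun φ => (hT φ).trans
      (by rw [mul_assoc]; exact mul_le_mul_of_nonneg_left (dlpNorm_le_norm_jetL1 m φ) hC.le)
  have hint : ∀ (φ ψ : DLp 1) (i : Fin (m + 1)),
      Integrable fun t => (φ t • jetL1 m (ψ.reflectAt (-t))) i := fun φ ψ i => by
    simp only [Pi.smul_apply, jetL1_reflectAt]
    exact integrable_smul_reflectL1 (dl1_integrable φ.2) (iteratedDeriv_smul_mem ψ.2 i)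
  have h1 : ∀ φ ψ : DLp 1, ∫ t, φ t * convDistr T ψ (-t)
      = Λ (∫ t, φ t • jetL1 m (ψ.reflectAt (-t))) := fun φ ψ => by
    rw [← Λ.integral_comp_comm (Integrable.of_eval (hint φ ψ))]
    refine integral_congr_ae (Eventually.of_forall fun t => ?_)
    simp only [map_smul, hΛ, smul_eq_mul]
    rfl
  rw [h1, h1]
  congr 1
  funext i
  rw [eval_integral (hint φ ψ), eval_integral (hint ψ φ)]
  simp only [Pi.smul_apply, jetL1_reflectAt]
  refine Lp.ext ?_
  refine (integral_smul_reflectL1_ae_eq (dl1_integrable φ.2) _).trans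
    (EventuallyEq.trans (Eventually.of_forall fun y => ?_)
      (integral_smul_reflectL1_ae_eq (dl1_integrable ψ.2) _).symm)
  have h2 : ∀ f g : ℝ → ℂ, ∫ t, f t * ((-1 : ℂ) ^ (i : ℕ) • iteratedDeriv i g) (-t - y)
      = (-1 : ℂ) ^ (i : ℕ) * ∫ t, f t * iteratedDeriv i g (-y - t) := fun f g => by
    rw [← integral_const_mul]
    refine integral_congr_ae (Eventually.of_forall fun t => ?_)
    simp only [Pi.smul_apply, smul_eq_mul]
    rw [mul_left_comm, neg_sub_comm]
  show ∫ t, φ.1 t * _ = ∫ t, ψ.1 t * _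
  rw [h2, h2, integral_mul_iteratedDeriv_comp_sub φ.2 ψ.2]

/-! ### Injectivity -/

/-- Uniqueness of limits as `ε → 0` depends on this; it holds because 0 is adherent to `]0, 1]`. -/
instance toZero_neBot : toZero.NeBot :=
  mem_closure_iff_comap_neBot.1 (by
    rw [closure_Ioc zero_ne_one]
    exact Set.left_mem_Icc.2 zero_le_one)

instance toZero_isCountablyGenerated : toZero.IsCountablyGenerated :=
  inferInstanceAs (comap _ _).IsCountablyGenerated

/-- Substituting `t = ε s` leaves `∫ ρ(s) v(-ε s) ds`, to which dominated convergence applies with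
majorant `C |ρ|`. -/
theorem tendsto_integral_scaled_mul (ρ : 𝓢(ℝ, ℂ)) {v : ℝ → ℂ} (hv : Continuous v) {C : ℝ}
    (hC : ∀ x, ‖v x‖ ≤ C) :
    Tendsto (fun ε => ∫ t, scaled ρ ε t * v (-t)) toZero (𝓝 ((∫ s, ρ s) * v 0)) := by
  have e : ∀ ε : ParamI, ∫ t, scaled ρ ε t * v (-t) = ∫ s, ρ s * v (-((ε : ℝ) * s)) := by
    intro ε
    have hε : (0 : ℝ) < ε := ε.2.1
    have h := Measure.integral_comp_div
      (fun s => (1 / (ε : ℝ) : ℂ) * (ρ s * v (-((ε : ℝ) * s)))) (ε : ℝ)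
    rw [abs_of_pos hε, integral_const_mul (1 / (ε : ℝ) : ℂ) fun s => ρ s * v (-((ε : ℝ) * s))] at h
    refine Eq.trans ?_ (h.trans ?_)
    · refine integral_congr_ae (Eventually.of_forall fun t => ?_)
      show (1 / (ε : ℝ) : ℂ) * ρ (t / ε) * v (-t) = _
      beta_reduce
      rw [mul_div_cancel₀ t hε.ne', mul_assoc]
    · have : (ε : ℂ) ≠ 0 := by exact_mod_cast hε.ne'
      rw [Complex.real_smul, ← mul_assoc, mul_one_div_cancel this, one_mul]
  simp only [e]
  rw [← integral_mul_const]
  refine tendsto_integral_filter_of_dominated_convergence (fun s => ‖ρ s‖ * C)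
    (Eventually.of_forall fun ε => ?_) (Eventually.of_forall fun ε => ?_)
    (ρ.integrable.norm.mul_const C) (Eventually.of_forall fun s => ?_)
  · exact (ρ.continuous.mul (hv.comp (continuous_const.mul continuous_id).neg)).aestronglyMeasurable
  · refine Eventually.of_forall fun s => ?_
    rw [norm_mul]
    exact mul_le_mul_of_nonneg_left (hC _) (norm_nonneg _)
  · refine Tendsto.const_mul _ ?_
    have h1 : Tendsto (fun ε : ParamI => -((ε : ℝ) * s)) toZero (𝓝 (-(0 * s))) :=
      (tendsto_comap.mul_const s).neg
    rw [zero_mul, neg_zero] at h1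
    exact (hv.tendsto 0).comp h1

/-- The essential bound holds on a set that is dense, having full measure, and closed, by
continuity; so it holds everywhere. -/
theorem norm_le_dlpNorm_top {f : ℝ → ℂ} (hf : f ∈ dlpSubmodule ∞) (x : ℝ) :
    ‖f x‖ ≤ dlpNorm ∞ 0 f := by
  have hm : MemLp f ∞ volume := by simpa using hf.2 0
  have h1 : ∀ᵐ y, ‖f y‖ ≤ dlpNorm ∞ 0 f := by
    filter_upwards [ae_le_eLpNormEssSup (f := f) (μ := volume)] with y hy
    have h := ENNReal.toReal_mono (b := eLpNorm f ∞ volume) hm.eLpNorm_ne_top hy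
    rw [toReal_enorm] at h
    simpa [dlpNorm] using h
  have h2 := (Measure.dense_of_ae h1).closure_eq
  rw [(isClosed_le hf.1.continuous.norm continuous_const).closure_eq] at h2
  exact (h2 ▸ Set.mem_univ x : x ∈ {y | ‖f y‖ ≤ dlpNorm ∞ 0 f})

theorem eq_zero_of_mollify_mem {ρ : 𝓢(ℝ, ℂ)} (hρ : ∫ x, ρ x = 1) {u : apDistributions}
    (hu : mollify ρ u ∈ NegligibleAp) : u = 0 := by
  have hconv : ∀ ψ : DLp 1, convDistr u ψ 0 = 0 := by
    intro ψ
    obtain ⟨C, hC⟩ := exists_norm_convDistr_le (u : BoundedDistribution) ψ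
    have h1 := tendsto_integral_scaled_mul ρ (continuous_convDistr (u : BoundedDistribution) ψ) hC
    rw [hρ, one_mul] at h1
    refine tendsto_nhds_unique h1 ?_
    simp only [integral_mul_convDistr_comm (u : BoundedDistribution) _ ψ]
    -- Decay of order `ε` in the sup norm is all that is needed from negligibility.
    have h2 : Tendsto (fun ε => dlpNorm ∞ 0 ((mollify ρ u).1 ε)) toZero (𝓝 0) :=
      (hu 0 1).trans_tendsto (by
        simp only [pow_one]
        exact tendsto_comap)
    have h3 := h2.const_mul (∫ t, ‖ψ t‖)
    rw [mul_zero] at h3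
    refine squeeze_zero_norm (fun ε => ?_) h3
    rw [← integral_mul_const]
    refine norm_integral_le_of_norm_le ((dl1_integrable ψ.2).norm.mul_const _)
      (Eventually.of_forall fun t => ?_)
    rw [norm_mul]
    exact mul_le_mul_of_nonneg_left (norm_le_dlpNorm_top ((mollify ρ u).1 ε).2.1 (-t))
      (norm_nonneg _)
  refine Subtype.ext (ContinuousLinearMap.ext fun φ => ?_)
  -- Reflection at 0 is an involution, so `T φ` is the value at 0 of `T` convolved with the
  -- reflected `φ`.
  have e : (φ.reflectAt 0).reflectAt 0 = φ := DLp.ext fun y => by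
    show φ (0 - (0 - y)) = φ y
    congr 1
    ring
  have := hconv (φ.reflectAt 0)
  rwa [convDistr, e] at this

/-- The embedding `u ↦ [(u * ρ_ε)_ε]`. -/
noncomputable def embedding (ρ : 𝓢(ℝ, ℂ)) : apDistributions →ₗ[ℂ] Gap :=
  (Ideal.Quotient.mkₐ ℂ NegligibleAp).toLinearMap ∘ₗ mollify ρ

theorem embedding_injective {ρ : 𝓢(ℝ, ℂ)} (hρ : ∫ x, ρ x = 1) :
    Function.Injective (embedding ρ) :=
  fun u v h => sub_eq_zero.1 (eq_zero_of_mollify_mem hρ (by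
    rw [map_sub]
    exact Ideal.Quotient.eq.1 h))

theorem embedding_derivAp (ρ : 𝓢(ℝ, ℂ)) (u : apDistributions) :
    embedding ρ (derivAp u) = Gap.deriv (embedding ρ u) :=
  congrArg (Ideal.Quotient.mk NegligibleAp) (mollify_derivAp ρ u)

end APGen

theorem mainTheorem1 (ρ : SchwartzMap ℝ ℂ) (hρ : ρ ∈ APGen.SigmaSet) :
    ∃ i : APGen.apDistributions →ₗ[ℂ] APGen.Gap,
      (∀ u : APGen.apDistributions, ∃ w : APGen.ModerateAp,
        (∀ ε : APGen.ParamI,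
          ((w : APGen.ParamI → APGen.Bap) ε : ℝ → ℂ)
            = APGen.convDistr (u : APGen.BoundedDistribution) (APGen.scaled ρ ε)) ∧
        i u = Ideal.Quotient.mk APGen.NegligibleAp w) ∧
      Function.Injective i ∧
      ∀ (j : ℕ) (u : APGen.apDistributions),
        i ((APGen.derivAp ^ j) u) = (APGen.Gap.deriv ^ j) (i u) := by
  refine ⟨APGen.embedding ρ, fun u => ⟨APGen.mollify ρ u, fun _ => rfl, rfl⟩,
    APGen.embedding_injective hρ.1, fun j u => ?_⟩
  induction j with
  | zero => rfl
  | succ j ih =>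
    rw [pow_succ', pow_succ', Module.End.mul_apply, Module.End.mul_apply, ← ih]
    exact APGen.embedding_derivAp ρ _
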